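/- Let $\mathcal A=\{H_1,\dots,H_l\}$ be an arrangement of $l$ distinct hyperplanes in $\mathbb{CP}^n$, with $H_i$ defined by the nonzero linear form $\alpha_i$. Let $E$ be the exterior algebra of $\mathbb C^l$ with canonical generators $x_1,\dots,x_l$, and let $A=E/K$ be the Orlik–Solomon algebra of $\mathcal A$, where $K$ is the two-sided ideal generated by the elements $$\partial(x_{i_1}\wedge\cdots\wedge x_{i_m})=\sum_{j=1}^m(-1)^j\,x_{i_1}\wedge\cdots\wedge x_{i_{j-1}}\wedge x_{i_{j+1}}\wedge\cdots\wedge x_{i_m}$$ for all distinct $i_1,\dots,i_m$ such that $H_{i_1},\dots,H_{i_m}$ intersect non-generically (that is, $\alpha_{i_1},\dots,\alpha_{i_m}$ are linearly dependent), together with the monomials $x_{i_1}\wedge\cdots\wedge x_{i_m}$ for all distinct $i_1,\dots,i_m$ with $H_{i_1}\cap\cdots\cap H_{i_m}=\emptyset$ in $\mathbb{CP}^n$. Let $M=(a_{ri})$ be an $n\times l$ complex matrix with columns $v_1,\dots,v_l\in\mathbb C^n$, and let $w_r=\sum_{i=1}^l a_{ri}x_i\in A$ for $r=1,\dots,n$.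 A flat of $\mathcal A$ is a nonempty subspace of $\mathbb{CP}^n$ that is the intersection of some of the hyperplanes of $\mathcal A$; for a flat $S$ put $v_S=\sum_{H_i\supseteq S}v_i$. Then $w_1\wedge\cdots\wedge w_n=0$ in $A$ if and only if, for every flag $S_1\supseteq\cdots\supseteq S_n$ of flats of $\mathcal A$, the vectors $v_{S_1},\dots,v_{S_n}$ span a subspace of $\mathbb C^n$ of dimension less than $n$ (the "flag condition"). -/

import Mathlib

open scoped LinearAlgebra.Projectivization

noncomputable section

/-- The complex projective space of dimension `n`. -/
abbrev CPn (n : ℕ) : Type := ℙ ℂ (Fin (n + 1) → ℂ)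

/-- The zero locus in projective space of a linear form in the homogeneous coordinates. -/
def zeroLocus {n : ℕ} (α : Module.Dual ℂ (Fin (n + 1) → ℂ)) : Set (CPn n) :=
  {p | p.submodule ≤ LinearMap.ker α}

/-- An arrangement of `l` distinct hyperplanes in the complex projective space of dimension `n`;
the `i`-th hyperplane is the zero locus of the nonzero linear form `form i`. -/
structure HyperplaneArrangement (n l : ℕ) where
  form : Fin l → Module.Dual ℂ (Fin (n + 1) → ℂ)
  form_ne_zero : ∀ i, form i ≠ 0
  distinct : Function.Injective fun i => zeroLocus (form i)

namespace HyperplaneArrangement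

variable {n l : ℕ} (A : HyperplaneArrangement n l)

/-- The `i`-th hyperplane, as a set of points of projective space. -/
def hyperplane (i : Fin l) : Set (CPn n) := zeroLocus (A.form i)

/-- The generator `x_i` of the exterior algebra on `ℂ^l`. -/
def x (i : Fin l) : ExteriorAlgebra ℂ (Fin l → ℂ) :=
  ExteriorAlgebra.ι ℂ (Pi.single i (1 : ℂ))

/-- The monomial `x_{i_1} ∧ ⋯ ∧ x_{i_m}`. -/
def monomial {m : ℕ} (i : Fin m → Fin l) : ExteriorAlgebra ℂ (Fin l → ℂ) :=
  (List.ofFn fun j => x (i j)).prod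

/-- The element `∂(x_{i_1} ∧ ⋯ ∧ x_{i_m})` for `m = k + 1 ≥ 1`, that is, the sum over `1 ≤ j ≤ m`
of `(-1)^j` times the monomial with its `j`-th factor removed (`j` is counted from `0` here). -/
def boundary {k : ℕ} (i : Fin (k + 1) → Fin l) : ExteriorAlgebra ℂ (Fin l → ℂ) :=
  ∑ j : Fin (k + 1), (-1 : ℂ) ^ ((j : ℕ) + 1) • monomial fun t => i (j.succAbove t)

/-- The hyperplanes with the given indices intersect non generically: their defining linear forms
are linearly dependent. -/
def NonGeneric {m : ℕ} (i : Fin m → Fin l) : Prop :=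
  ¬ LinearIndependent ℂ fun j => A.form (i j)

/-- The generators of the Orlik–Solomon ideal: the elements `∂(x_{i_1} ∧ ⋯ ∧ x_{i_m})` for distinct
hyperplanes that intersect non generically, and the monomials `x_{i_1} ∧ ⋯ ∧ x_{i_m}` for distinct
hyperplanes without a common point in projective space. -/
def relators : Set (ExteriorAlgebra ℂ (Fin l → ℂ)) :=
  {e | ∃ (k : ℕ) (i : Fin (k + 1) → Fin l),
      Function.Injective i ∧ A.NonGeneric i ∧ e = boundary i} ∪
  {e | ∃ (m : ℕ) (i : Fin m → Fin l),
      Function.Injective i ∧ (⋂ j, A.hyperplane (i j)) = ∅ ∧ e = monomial i}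

/-- The Orlik–Solomon ideal, a two-sided ideal of the exterior algebra. -/
def osIdeal : TwoSidedIdeal (ExteriorAlgebra ℂ (Fin l → ℂ)) :=
  TwoSidedIdeal.span A.relators

/-- The Orlik–Solomon algebra. -/
abbrev OSAlgebra : Type := A.osIdeal.ringCon.Quotient

/-- The class of `x_i` in the Orlik–Solomon algebra. -/
def gen (i : Fin l) : A.OSAlgebra := A.osIdeal.ringCon.mk' (x i)

/-- A flat of the arrangement: a nonempty intersection of some of its hyperplanes. -/
def IsFlat (S : Set (CPn n)) : Prop :=
  S.Nonempty ∧ ∃ I : Set (Fin l), S = ⋂ i ∈ I, A.hyperplane i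

/-- A flag `S_1 ⊇ ⋯ ⊇ S_m` of flats. -/
def IsFlag {m : ℕ} (S : Fin m → Set (CPn n)) : Prop :=
  (∀ k, A.IsFlat (S k)) ∧ Antitone S

open Classical in
/-- The decoration `v_S` of a flat `S` by the sum of the columns of `M` that belong to the
hyperplanes containing `S`. -/
def decoration {m : ℕ} (M : Matrix (Fin m) (Fin l) ℂ) (S : Set (CPn n)) : Fin m → ℂ :=
  ∑ i : Fin l with S ⊆ A.hyperplane i, M.col i

end HyperplaneArrangement

end

/-! A flag `S` sends each generator to its incidence vector, and the induced map of exterior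
algebras kills the Orlik–Solomon ideal (`osIdeal_le_ker_map_incidenceMap`). For a flag of length
`n`, following it by the determinant gives a functional whose value on `w_1 ∧ ⋯ ∧ w_n` is the
determinant of the vectors `v_{S_k}`; hence vanishing forces the flag condition.

Conversely, modulo the ideal, degree `n` is spanned by standard monomials
(`monomial_mem_standardSpan`). The functionals of their tail flags are dual to them up to nonzero
scalars (`flagFunctional_tailFlag_self`, `eq_of_flagFunctional_tailFlag_ne_zero`), so a degree `n`
product killed by all of them has no standard component and lies in the ideal. -/

noncomputable section

-- Append a coordinate 1 to each vector: up to sign, the sum is the value at `(u j, 1)` of the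
-- alternatization of `(v, c) ↦ c • ιMulti`, and alternating maps vanish on repeated arguments.
open ExteriorAlgebra in
theorem sum_neg_one_pow_smul_ιMulti_succAbove_eq_zero {V : Type*} [AddCommGroup V] [Module ℂ V]
    {k : ℕ} (u : Fin (k + 1) → V) (hu : ¬ Function.Injective u) :
    ∑ j : Fin (k + 1), (-1 : ℂ) ^ ((j : ℕ) + 1) • ιMulti ℂ k (fun t => u (j.succAbove t)) = 0 := by
  let f : (V × ℂ) →ₗ[ℂ] (V × ℂ) [⋀^Fin k]→ₗ[ℂ] ExteriorAlgebra ℂ V :=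
    (LinearMap.snd ℂ V ℂ).smulRight ((ιMulti ℂ k).compLinearMap (LinearMap.fst ℂ V ℂ))
  have h : AlternatingMap.alternatizeUncurryFin f (fun j => (u j, (1 : ℂ))) = 0 := by
    apply AlternatingMap.map_eq_zero_of_not_injective
    intro h
    exact hu fun a b hab => h (by simp [hab])
  rw [AlternatingMap.alternatizeUncurryFin_apply] at h
  rw [← neg_eq_zero, ← h, ← Finset.sum_neg_distrib]
  refine Finset.sum_congr rfl fun j _ => ?_
  have : f (u j, 1) (j.removeNth fun j => (u j, (1 : ℂ)))
      = ιMulti ℂ k (fun t => u (j.succAbove t)) := by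
    simp [f, Fin.removeNth]
  rw [this, pow_succ]
  rcases neg_one_pow_eq_or ℤ (j : ℕ) with h1 | h1
  · have : (-1 : ℂ) ^ (j : ℕ) = 1 := by exact_mod_cast h1
    simp [h1, this]
  · have : (-1 : ℂ) ^ (j : ℕ) = -1 := by exact_mod_cast h1
    simp [h1, this]

namespace HyperplaneArrangement

variable {n l : ℕ} (A : HyperplaneArrangement n l)

/-! ### Inclusions of hyperplane intersections as span conditions on forms. -/

theorem mem_hyperplane_iff {i : Fin l} {p : CPn n} :
    p ∈ A.hyperplane i ↔ A.form i p.rep = 0 := by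
  rw [hyperplane, zeroLocus, Set.mem_ofPred_eq, p.submodule_eq,
    Submodule.span_singleton_le_iff_mem, LinearMap.mem_ker]

theorem mk_mem_hyperplane_iff {i : Fin l} {v : Fin (n + 1) → ℂ} (hv : v ≠ 0) :
    Projectivization.mk ℂ v hv ∈ A.hyperplane i ↔ A.form i v = 0 := by
  rw [hyperplane, zeroLocus, Set.mem_ofPred_eq, Projectivization.submodule_mk,
    Submodule.span_singleton_le_iff_mem, LinearMap.mem_ker]

theorem subset_hyperplane_of_mem_span {S : Set (CPn n)} {I : Set (Fin l)}
    (hI : ∀ i ∈ I, S ⊆ A.hyperplane i) {j : Fin l}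
    (hj : A.form j ∈ Submodule.span ℂ (A.form '' I)) : S ⊆ A.hyperplane j := by
  intro p hp
  rw [mem_hyperplane_iff]
  have : Submodule.span ℂ (A.form '' I) ≤ LinearMap.ker (LinearMap.applyₗ (R := ℂ) p.rep) := by
    rw [Submodule.span_le]
    rintro _ ⟨i, hi, rfl⟩
    exact A.mem_hyperplane_iff.1 (hI i hi hp)
  exact this hj

theorem mem_span_of_iInter_subset {I : Set (Fin l)} {j : Fin l}
    (h : ⋂ i ∈ I, A.hyperplane i ⊆ A.hyperplane j) :
    A.form j ∈ Submodule.span ℂ (A.form '' I) := by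
  have key := mem_span_of_iInf_ker_le_ker (L := fun i : I => A.form i) (K := A.form j) (by
    intro v hv
    by_cases h0 : v = 0
    · simp [h0]
    rw [LinearMap.mem_ker, ← A.mk_mem_hyperplane_iff h0]
    apply h
    rw [Set.mem_iInter₂]
    intro i hi
    rw [A.mk_mem_hyperplane_iff h0]
    exact (Submodule.mem_iInf _).1 hv ⟨i, hi⟩)
  rwa [← Set.image_eq_range] at key

theorem iInter_subset_hyperplane_iff {I : Set (Fin l)} {j : Fin l} :
    ⋂ i ∈ I, A.hyperplane i ⊆ A.hyperplane j ↔
      A.form j ∈ Submodule.span ℂ (A.form '' I) :=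
  ⟨A.mem_span_of_iInter_subset,
    A.subset_hyperplane_of_mem_span fun _ hi => Set.biInter_subset_of_mem hi⟩

/-- The ambient space has dimension `n + 1`, so `n` forms share a nonzero zero. This makes tail
flags of length `n` consist of flats. -/
theorem iInter_hyperplane_nonempty (i : Fin n → Fin l) :
    (⋂ t, A.hyperplane (i t)).Nonempty := by
  have h := LinearMap.ker_ne_bot_of_finrank_lt
    (f := LinearMap.pi fun t => A.form (i t)) (by simp)
  obtain ⟨v, hv, h0⟩ := Submodule.exists_mem_ne_zero_of_ne_bot h
  refine ⟨Projectivization.mk ℂ v h0, Set.mem_iInter.2 fun t => ?_⟩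
  rw [A.mk_mem_hyperplane_iff h0]
  exact congrFun hv t

/-! ### Incidence vectors of a flag. -/

open Classical in
/-- The vector recording which members of a family of sets lie in the `j`-th hyperplane. -/
def incidence {m : ℕ} (S : Fin m → Set (CPn n)) (j : Fin l) : Fin m → ℂ :=
  fun k => if S k ⊆ A.hyperplane j then 1 else 0

theorem incidence_eq_incidence_iff {m : ℕ} {S : Fin m → Set (CPn n)} {i j : Fin l} :
    A.incidence S i = A.incidence S j ↔
      ∀ k, S k ⊆ A.hyperplane i ↔ S k ⊆ A.hyperplane j := by
  rw [funext_iff]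
  refine forall_congr' fun k => ?_
  unfold incidence
  by_cases h1 : S k ⊆ A.hyperplane i <;> by_cases h2 : S k ⊆ A.hyperplane j <;> simp [h1, h2]

theorem incidence_eq_zero_iff {m : ℕ} {S : Fin m → Set (CPn n)} {j : Fin l} :
    A.incidence S j = 0 ↔ ∀ k, ¬ S k ⊆ A.hyperplane j := by
  simp [funext_iff, incidence]

/-- Hyperplanes that are separated by a flag have independent forms. -/
theorem linearIndependent_form_of_incidence_injective {m r : ℕ} {S : Fin m → Set (CPn n)}
    (hS : Antitone S) (i : Fin r → Fin l)
    (hi : Function.Injective fun p => A.incidence S (i p)) :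
    LinearIndependent ℂ fun p => A.form (i p) := by
  classical
  rw [Fintype.linearIndependent_iff]
  intro c hc
  by_contra! hne
  -- Each `N p` is an initial segment, since the flag decreases. In a linear relation, a term with
  -- the largest `N p` is spanned by the other terms, which is contradictory.
  let N : Fin r → Finset (Fin m) := fun p => {k | ¬ S k ⊆ A.hyperplane (i p)}
  obtain ⟨p, hp, hmax⟩ := Finset.exists_max_image (Finset.univ.filter fun p => c p ≠ 0)
    (fun p => (N p).card) (by obtain ⟨p, hp⟩ := hne; exact ⟨p, by simpa using hp⟩)
  simp only [Finset.mem_filter, Finset.mem_univ, true_and] at hp hmax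
  have hlow : ∀ q k k', k ∈ N q → k' ≤ k → k' ∈ N q := by
    intro q k k' hk hkk
    simp only [N, Finset.mem_filter, Finset.mem_univ, true_and] at hk ⊢
    exact fun h => hk ((hS hkk).trans h)
  have hform : A.form (i p) ∈ Submodule.span ℂ (A.form '' {j | ∃ q ≠ p, c q ≠ 0 ∧ i q = j}) := by
    rw [← Finset.add_sum_erase _ _ (Finset.mem_univ p)] at hc
    have : A.form (i p) = (- (c p)⁻¹) • ∑ q ∈ Finset.univ.erase p, c q • A.form (i q) := by
      rw [eq_neg_of_add_eq_zero_right hc]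
      simp [smul_smul, hp]
    rw [this]
    refine Submodule.smul_mem _ _ (Submodule.sum_mem _ fun q hq => ?_)
    by_cases hq0 : c q = 0
    · simp [hq0]
    · exact Submodule.smul_mem _ _ (Submodule.subset_span
        ⟨i q, ⟨q, Finset.ne_of_mem_erase hq, hq0, rfl⟩, rfl⟩)
  -- If `N p` is empty, so is `N q` for every other term; separation then leaves `p` alone in the
  -- relation.
  rcases (N p).eq_empty_or_nonempty with h0 | h0
  · have : {j | ∃ q ≠ p, c q ≠ 0 ∧ i q = j} = ∅ := by
      rw [Set.eq_empty_iff_forall_notMem]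
      rintro _ ⟨q, hqp, hq, rfl⟩
      have h1 := hmax q hq
      rw [h0, Finset.card_empty, Nat.le_zero, Finset.card_eq_zero] at h1
      refine hqp (hi (A.incidence_eq_incidence_iff.2 fun k => ?_))
      have h2 : k ∉ N q := by simp [h1]
      have h3 : k ∉ N p := by simp [h0]
      simp only [N, Finset.mem_filter, Finset.mem_univ, true_and, not_not] at h2 h3
      simp [h2, h3]
    rw [this] at hform
    simp at hform
    exact A.form_ne_zero _ hform
  · have hk := (N p).max'_mem h0
    set k := (N p).max' h0 with hkdef
    have hk' := hk
    simp only [N, Finset.mem_filter, Finset.mem_univ, true_and] at hk'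
    -- At the last `k` of `N p`, every other term contains `S k`: otherwise `N p ⊆ N q`, with
    -- equality by maximality, against separation.
    refine hk' (A.subset_hyperplane_of_mem_span ?_ hform)
    rintro _ ⟨q, hqp, hq, rfl⟩
    by_contra hkq
    have hkq : k ∈ N q := by simpa [N] using hkq
    have hsub : N p ⊆ N q := fun k' hk' => hlow q k k' hkq ((N p).le_max' _ hk')
    have heq := Finset.eq_of_subset_of_card_le hsub (hmax q hq)
    refine hqp (hi (A.incidence_eq_incidence_iff.2 fun k => ?_))
    have := Finset.ext_iff.1 heq k
    simp only [N, Finset.mem_filter, Finset.mem_univ, true_and] at this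
    exact (not_iff_not.1 this).symm

/-! ### Functionals attached to flags. -/

theorem monomial_eq_ιMulti {m : ℕ} (i : Fin m → Fin l) :
    monomial i = ExteriorAlgebra.ιMulti ℂ m fun j => Pi.single (i j) (1 : ℂ) :=
  (ExteriorAlgebra.ιMulti_apply _).symm

/-- The linear extension of `incidence`. -/
def incidenceMap {m : ℕ} (S : Fin m → Set (CPn n)) : (Fin l → ℂ) →ₗ[ℂ] Fin m → ℂ :=
  Fintype.linearCombination ℂ (A.incidence S)

theorem incidenceMap_single {m : ℕ} (S : Fin m → Set (CPn n)) (j : Fin l) :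
    A.incidenceMap S (Pi.single j 1) = A.incidence S j := by
  simp [incidenceMap, Fintype.linearCombination_apply_single]

theorem incidenceMap_row {m : ℕ} (S : Fin m → Set (CPn n)) (M : Matrix (Fin m) (Fin l) ℂ)
    (r k : Fin m) : A.incidenceMap S (M r) k = A.decoration M (S k) r := by
  simp [incidenceMap, Fintype.linearCombination_apply, incidence, decoration, Finset.sum_filter,
    Finset.sum_apply]

theorem map_incidenceMap_monomial {m r : ℕ} (S : Fin m → Set (CPn n)) (i : Fin r → Fin l) :
    ExteriorAlgebra.map (A.incidenceMap S) (monomial i) =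
      ExteriorAlgebra.ιMulti ℂ r fun p => A.incidence S (i p) := by
  rw [monomial_eq_ιMulti, ExteriorAlgebra.map_apply_ιMulti]
  simp [Function.comp_def, incidenceMap_single]

/-- Dependent forms have two equal incidence vectors, which kills the boundary. For an empty
intersection some incidence vector is zero: otherwise every hyperplane would contain the smallest
member of the flag. -/
theorem osIdeal_le_ker_map_incidenceMap {m : ℕ} {S : Fin m → Set (CPn n)} (hS : Antitone S)
    (hne : ∀ k, (S k).Nonempty) :
    A.osIdeal ≤ TwoSidedIdeal.ker (ExteriorAlgebra.map (A.incidenceMap S)) := by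
  rw [osIdeal, TwoSidedIdeal.span_le]
  rintro _ (⟨k, i, -, hdep, rfl⟩ | ⟨r, i, -, hempty, rfl⟩)
  · rw [SetLike.mem_coe, TwoSidedIdeal.mem_ker, boundary]
    simp only [map_sum, map_smul, map_incidenceMap_monomial]
    exact sum_neg_one_pow_smul_ιMulti_succAbove_eq_zero (fun p => A.incidence S (i p))
      fun h => hdep (A.linearIndependent_form_of_incidence_injective hS i h)
  · rw [SetLike.mem_coe, TwoSidedIdeal.mem_ker, map_incidenceMap_monomial]
    by_cases h : ∃ p, A.incidence S (i p) = 0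
    · obtain ⟨p, hp⟩ := h
      exact AlternatingMap.map_coord_zero _ p hp
    simp only [incidence_eq_zero_iff, not_exists, not_forall, not_not] at h
    exfalso
    -- An empty flag has no smallest member; then `r = 0`, and the empty intersection is the whole
    -- space.
    rcases m with _ | m
    · rcases r with _ | r
      · simp at hempty
      · obtain ⟨k, -⟩ := h 0
        exact k.elim0
    · obtain ⟨q, hq⟩ := hne (Fin.last m)
      have : q ∈ ⋂ p, A.hyperplane (i p) := Set.mem_iInter.2 fun p => by
        obtain ⟨k, hk⟩ := h p
        exact hk (hS (Fin.le_last k) hq)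
      rw [hempty] at this
      exact this

/-- The functional of a flag: the determinant of the incidence vectors. -/
def flagFunctional {m : ℕ} (S : Fin m → Set (CPn n)) : ExteriorAlgebra ℂ (Fin l → ℂ) →ₗ[ℂ] ℂ :=
  -- Zero in every degree other than `m`.
  ExteriorAlgebra.liftAlternating (Pi.single m Matrix.detRowAlternating) ∘ₗ
    (ExteriorAlgebra.map (A.incidenceMap S)).toLinearMap

theorem flagFunctional_ιMulti {m : ℕ} (S : Fin m → Set (CPn n)) (v : Fin m → Fin l → ℂ) :
    A.flagFunctional S (ExteriorAlgebra.ιMulti ℂ m v) =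
      Matrix.det (Matrix.of fun r => A.incidenceMap S (v r)) := by
  simp [flagFunctional, ExteriorAlgebra.map_apply_ιMulti,
    ExteriorAlgebra.liftAlternating_apply_ιMulti]
  rfl

theorem flagFunctional_monomial {m : ℕ} (S : Fin m → Set (CPn n)) (i : Fin m → Fin l) :
    A.flagFunctional S (monomial i) = Matrix.det (Matrix.of fun r => A.incidence S (i r)) := by
  simp only [monomial_eq_ιMulti, flagFunctional_ιMulti, incidenceMap_single]

theorem flagFunctional_eq_zero_of_mem {m : ℕ} {S : Fin m → Set (CPn n)} (hS : Antitone S)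
    (hne : ∀ k, (S k).Nonempty) {e : ExteriorAlgebra ℂ (Fin l → ℂ)} (he : e ∈ A.osIdeal) :
    A.flagFunctional S e = 0 := by
  have := (TwoSidedIdeal.mem_ker _).1 (A.osIdeal_le_ker_map_incidenceMap hS hne he)
  simp [flagFunctional, this]

theorem flagFunctional_rows_eq_zero_iff (S : Fin n → Set (CPn n)) (M : Matrix (Fin n) (Fin l) ℂ) :
    A.flagFunctional S (ExteriorAlgebra.ιMulti ℂ n fun r => M r) = 0 ↔
      Module.finrank ℂ (Submodule.span ℂ (Set.range fun k => A.decoration M (S k))) < n := by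
  have h1 : (Matrix.of fun r => A.incidenceMap S (M r)).transpose =
      Matrix.of fun k => A.decoration M (S k) := by
    ext k r
    exact A.incidenceMap_row S M r k
  rw [flagFunctional_ιMulti, ← Matrix.det_transpose, h1]
  have h2 := Matrix.linearIndependent_rows_iff_isUnit (A := Matrix.of fun k => A.decoration M (S k))
  rw [Matrix.isUnit_iff_isUnit_det, isUnit_iff_ne_zero] at h2
  rw [← not_iff_not, ← ne_eq, ← h2, not_lt, linearIndependent_iff_card_le_finrank_span,
    Fintype.card_fin]
  rfl

/-! ### Dependent monomials and their boundaries. -/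

theorem monomial_cons {m : ℕ} (j : Fin l) (i : Fin m → Fin l) :
    monomial (Fin.cons j i : Fin (m + 1) → Fin l) = x j * monomial i := by
  simp [monomial, List.ofFn_succ]

theorem monomial_eq_zero_of_not_injective {m : ℕ} {i : Fin m → Fin l}
    (hi : ¬ Function.Injective i) : monomial i = 0 := by
  rw [monomial_eq_ιMulti]
  refine AlternatingMap.map_eq_zero_of_not_injective _ _ fun h => hi fun a b hab => h ?_
  simp [hab]

/-- Repeated indices, excluded from the relators, give a zero boundary. The straightening below
needs this case. -/
theorem boundary_mem_osIdeal {k : ℕ} {i : Fin (k + 1) → Fin l} (hi : A.NonGeneric i) :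
    boundary i ∈ A.osIdeal := by
  by_cases hinj : Function.Injective i
  · exact TwoSidedIdeal.subset_span (Or.inl ⟨k, i, hinj, hi, rfl⟩)
  · have hns : ¬ Function.Injective fun p => (Pi.single (i p) (1 : ℂ) : Fin l → ℂ) :=
      fun h => hinj (Function.Injective.of_comp (f := fun j => (Pi.single j (1 : ℂ) : Fin l → ℂ)) h)
    have h0 : boundary i = 0 :=
      (Finset.sum_congr rfl fun j _ => by rw [monomial_eq_ιMulti]).trans
        (sum_neg_one_pow_smul_ιMulti_succAbove_eq_zero _ hns)
    rw [h0]
    exact A.osIdeal.zero_mem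

theorem x_mul_boundary {k : ℕ} (i : Fin (k + 1) → Fin l) :
    x (i 0) * boundary i = -monomial i := by
  rw [boundary, Finset.mul_sum, Finset.sum_eq_single 0]
  · rw [← Fin.cons_self_tail i, monomial_cons]
    simp [Fin.tail_def]
  · intro j _ hj
    rw [mul_smul_comm, ← monomial_cons, monomial_eq_zero_of_not_injective, smul_zero]
    obtain ⟨t, ht⟩ := Fin.exists_succAbove_eq hj.symm
    intro h
    have := @h 0 t.succ (by simp [ht])
    exact Fin.succ_ne_zero t this.symm
  · simp

theorem monomial_mem_osIdeal {m : ℕ} {i : Fin m → Fin l} (hi : A.NonGeneric i) :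
    monomial i ∈ A.osIdeal := by
  rcases m with _ | m
  · exact absurd (linearIndependent_empty_type) hi
  · rw [← neg_neg (monomial i), ← x_mul_boundary]
    exact A.osIdeal.neg_mem (A.osIdeal.mul_mem_left _ _ (A.boundary_mem_osIdeal hi))

theorem boundary_cons {m : ℕ} (j : Fin l) (i : Fin (m + 1) → Fin l) :
    boundary (Fin.cons j i : Fin (m + 2) → Fin l) =
      -monomial i + x j * ∑ k : Fin (m + 1), (-1 : ℂ) ^ (k : ℕ) • monomial fun t => i (k.succAbove t) := by
  rw [boundary, Fin.sum_univ_succ, Finset.mul_sum]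
  congr 1
  · simp
  · refine Finset.sum_congr rfl fun k _ => ?_
    have : (fun t => (Fin.cons j i : Fin (m + 2) → Fin l) (k.succ.succAbove t)) =
        (Fin.cons j (fun t => i (k.succAbove t)) : Fin (m + 1) → Fin l) := by
      ext t
      refine Fin.cases ?_ (fun t => ?_) t <;> simp
    rw [this, monomial_cons, mul_smul_comm]
    congr 1
    simp [pow_succ]

/-! ### Straightening into standard monomials. -/

/-- The Orlik–Solomon ideal as a linear subspace. -/
def osSubmodule : Submodule ℂ (ExteriorAlgebra ℂ (Fin l → ℂ)) where
  carrier := {e | e ∈ A.osIdeal}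
  add_mem' := A.osIdeal.add_mem
  zero_mem' := A.osIdeal.zero_mem
  smul_mem' c e he := by
    rw [Algebra.smul_def]
    exact A.osIdeal.mul_mem_left _ _ he

theorem mem_osSubmodule {e : ExteriorAlgebra ℂ (Fin l → ℂ)} :
    e ∈ A.osSubmodule ↔ e ∈ A.osIdeal := Iff.rfl

/-- The forms with indices in a tuple are independent, and each index is the least one whose form
lies in the span of the forms from there on. -/
structure IsStandard {m : ℕ} (i : Fin m → Fin l) : Prop where
  linearIndependent : LinearIndependent ℂ fun t => A.form (i t)
  le : ∀ t j, A.form j ∈ Submodule.span ℂ (A.form '' (i '' Set.Ici t)) → i t ≤ j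

theorem IsStandard.cons {m : ℕ} {i : Fin m → Fin l} (hi : A.IsStandard i) {j : Fin l}
    (hj : A.form j ∉ Submodule.span ℂ (A.form '' Set.range i))
    (hmin : ∀ j', A.form j' ∈ Submodule.span ℂ (A.form '' Set.range (Fin.cons j i : Fin (m + 1) → _))
      → j ≤ j') : A.IsStandard (Fin.cons j i : Fin (m + 1) → Fin l) where
  linearIndependent := by
    rw [linearIndependent_finSucc]
    refine ⟨by simpa [Fin.tail_def] using hi.linearIndependent, ?_⟩
    rw [← Set.range_comp] at hj
    simpa [Fin.tail_def, Function.comp_def] using hj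
  le t := by
    refine Fin.cases ?_ (fun t => ?_) t
    · intro j' hj'
      refine hmin j' (Submodule.span_mono (Set.image_mono (Set.image_subset_range _ _)) hj')
    · intro j' hj'
      have himage : (Fin.cons j i : Fin (m + 1) → Fin l) '' Set.Ici t.succ = i '' Set.Ici t := by
        rw [← Fin.image_succ_Ici, Set.image_image]
        simp only [Fin.cons_succ]
      rw [himage] at hj'
      exact hi.le t j' hj'

/-- The span of the standard monomials of degree `m` whose forms lie in a given subspace. -/
def standardSpan (m : ℕ) (X : Submodule ℂ (Module.Dual ℂ (Fin (n + 1) → ℂ))) :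
    Submodule ℂ (ExteriorAlgebra ℂ (Fin l → ℂ)) :=
  Submodule.span ℂ {e | ∃ i : Fin m → Fin l,
    A.IsStandard i ∧ (∀ t, A.form (i t) ∈ X) ∧ e = monomial i}

theorem standardSpan_mono (m : ℕ) {X Y : Submodule ℂ (Module.Dual ℂ (Fin (n + 1) → ℂ))}
    (h : X ≤ Y) : A.standardSpan m X ≤ A.standardSpan m Y :=
  Submodule.span_mono fun _ ⟨i, hi, hX, he⟩ => ⟨i, hi, fun t => h (hX t), he⟩

/-- Prepending the least index of `X` to a standard tuple either creates a dependence, so the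
monomial is in the ideal, or keeps the tuple standard. -/
theorem x_mul_mem_standardSpan {m : ℕ} {X : Submodule ℂ (Module.Dual ℂ (Fin (n + 1) → ℂ))}
    {j : Fin l} (hj : A.form j ∈ X) (hmin : ∀ j', A.form j' ∈ X → j ≤ j')
    {e : ExteriorAlgebra ℂ (Fin l → ℂ)} (he : e ∈ A.osSubmodule ⊔ A.standardSpan m X) :
    x j * e ∈ A.osSubmodule ⊔ A.standardSpan (m + 1) X := by
  have : A.osSubmodule ⊔ A.standardSpan m X ≤
      (A.osSubmodule ⊔ A.standardSpan (m + 1) X).comap (LinearMap.mulLeft ℂ (x j)) := by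
    refine sup_le ?_ ?_
    · intro e he
      exact Submodule.mem_sup_left (A.osIdeal.mul_mem_left _ _ he)
    · rw [standardSpan, Submodule.span_le]
      rintro _ ⟨i, hi, hX, rfl⟩
      rw [SetLike.mem_coe, Submodule.mem_comap, LinearMap.mulLeft_apply, ← monomial_cons]
      by_cases hji : A.form j ∈ Submodule.span ℂ (A.form '' Set.range i)
      · refine Submodule.mem_sup_left (A.monomial_mem_osIdeal fun h => ?_)
        rw [linearIndependent_finSucc] at h
        apply h.2
        rw [← Set.range_comp] at hji
        simpa [Fin.tail_def, Function.comp_def] using hji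
      · have hX' : ∀ t, A.form ((Fin.cons j i : Fin (m + 1) → Fin l) t) ∈ X := by
          refine Fin.cases ?_ ?_ <;> simp [hj, hX]
        refine Submodule.mem_sup_right (Submodule.subset_span
          ⟨_, hi.cons A hji fun j' hj' => hmin j' ?_, hX', rfl⟩)
        refine Submodule.span_le.2 ?_ hj'
        rintro _ ⟨_, ⟨t, rfl⟩, rfl⟩
        exact hX' t
  exact this he

theorem monomial_mem_standardSpan {m : ℕ} (i : Fin m → Fin l) :
    monomial i ∈ A.osSubmodule ⊔
      A.standardSpan m (Submodule.span ℂ (A.form '' Set.range i)) := by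
  induction m with
  | zero =>
    exact Submodule.mem_sup_right (Submodule.subset_span
      ⟨i, ⟨linearIndependent_empty_type, fun t => t.elim0⟩, fun t => t.elim0, rfl⟩)
  | succ m ih =>
    set X := Submodule.span ℂ (A.form '' Set.range i) with hXdef
    have hX : ∀ t, A.form (i t) ∈ X := fun t => Submodule.subset_span ⟨_, ⟨t, rfl⟩, rfl⟩
    -- Prepending the least index `j` of the span gives a dependent tuple, whose boundary rewrites
    -- `monomial i` as `x j` times lower-degree monomials, ready for induction.
    obtain ⟨j, hj, hmin⟩ : ∃ j, A.form j ∈ X ∧ ∀ j', A.form j' ∈ X → j ≤ j' := by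
      obtain ⟨j, hj, h⟩ := wellFounded_lt.has_min {j : Fin l | A.form j ∈ X} ⟨i 0, hX 0⟩
      exact ⟨j, hj, fun j' hj' => not_lt.1 (h j' hj')⟩
    have hdep : A.NonGeneric (Fin.cons j i : Fin (m + 2) → Fin l) := by
      intro h
      rw [linearIndependent_finSucc] at h
      apply h.2
      rw [hXdef, ← Set.range_comp] at hj
      simpa [Fin.tail_def, Function.comp_def] using hj
    have hb := A.boundary_mem_osIdeal hdep
    rw [boundary_cons] at hb
    set e := x j * ∑ k : Fin (m + 1), (-1 : ℂ) ^ (k : ℕ) • monomial fun t => i (k.succAbove t) with he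
    have : monomial i = -(-monomial i + e) + e := by abel
    rw [this]
    refine Submodule.add_mem _ (Submodule.mem_sup_left (A.osIdeal.neg_mem hb)) ?_
    refine A.x_mul_mem_standardSpan hj hmin (Submodule.sum_mem _ fun k _ =>
      Submodule.smul_mem _ _ (sup_le_sup_left (A.standardSpan_mono m ?_) _ (ih _)))
    exact Submodule.span_mono (Set.image_mono (by rintro _ ⟨t, rfl⟩; exact ⟨_, rfl⟩))

theorem ιMulti_mem_standardSpan {m : ℕ} (v : Fin m → Fin l → ℂ) :
    ExteriorAlgebra.ιMulti ℂ m v ∈ A.osSubmodule ⊔ A.standardSpan m ⊤ := by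
  have h : v = fun r => ∑ j, v r j • Pi.single j (1 : ℂ) := by
    ext r j
    simp [Finset.sum_apply, Pi.single_apply]
  rw [h, ← AlternatingMap.coe_multilinearMap, MultilinearMap.map_sum]
  refine Submodule.sum_mem _ fun i _ => ?_
  rw [MultilinearMap.map_smul_univ, AlternatingMap.coe_multilinearMap, ← monomial_eq_ιMulti]
  exact Submodule.smul_mem _ _
    (sup_le_sup_left (A.standardSpan_mono m le_top) _ (A.monomial_mem_standardSpan i))

/-! ### Duality between tail flags and standard monomials. -/

/-- The flag obtained by intersecting the hyperplanes with indices in a tuple one after the other,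
starting with the last one. -/
def tailFlag {m : ℕ} (i : Fin m → Fin l) (k : Fin m) : Set (CPn n) :=
  ⋂ j ∈ i '' Set.Ici k.rev, A.hyperplane j

theorem isFlag_tailFlag (i : Fin n → Fin l) : A.IsFlag (A.tailFlag i) := by
  refine ⟨fun k => ⟨?_, _, rfl⟩, fun k k' h => ?_⟩
  · refine (A.iInter_hyperplane_nonempty i).mono fun p hp => ?_
    simp only [tailFlag, Set.mem_iInter, Set.mem_image] at hp ⊢
    rintro _ ⟨t, -, rfl⟩
    exact hp t
  · refine Set.biInter_subset_biInter_left (Set.image_mono (Set.Ici_subset_Ici.2 ?_))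
    exact Fin.rev_le_rev.2 h

theorem incidence_tailFlag {m : ℕ} (i : Fin m → Fin l) (j : Fin l) (t : Fin m) [Decidable
    (A.form j ∈ Submodule.span ℂ (A.form '' (i '' Set.Ici t)))] :
    A.incidence (A.tailFlag i) j t.rev =
      if A.form j ∈ Submodule.span ℂ (A.form '' (i '' Set.Ici t)) then 1 else 0 := by
  simp only [incidence, tailFlag, iInter_subset_hyperplane_iff, Fin.rev_rev]

theorem notMem_span_of_lt {m : ℕ} {i : Fin m → Fin l}
    (hi : LinearIndependent ℂ fun t => A.form (i t)) {s t : Fin m} (h : s < t) :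
    A.form (i s) ∉ Submodule.span ℂ (A.form '' (i '' Set.Ici t)) := by
  rw [Set.image_image]
  exact hi.notMem_span_image (by simpa using h)

theorem flagFunctional_tailFlag_self {i : Fin n → Fin l} (hi : A.IsStandard i) :
    A.flagFunctional (A.tailFlag i) (monomial i) ≠ 0 := by
  classical
  rw [flagFunctional_monomial]
  set N : Matrix (Fin n) (Fin n) ℂ := Matrix.of fun r => A.incidence (A.tailFlag i) (i r)
  -- Reversing the columns undoes the `rev` in `tailFlag`; independence makes the matrix lower
  -- unitriangular.
  have h1 : (N.submatrix id Fin.revPerm).det = 1 := by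
    rw [Matrix.det_of_isLowerTriangular]
    · refine Finset.prod_eq_one fun t _ => ?_
      simp only [N, Matrix.submatrix_apply, Matrix.of_apply, id, Fin.revPerm_apply,
        incidence_tailFlag]
      rw [if_pos]
      exact Submodule.subset_span ⟨_, ⟨t, by simp, rfl⟩, rfl⟩
    · intro s t hst
      simp only [N, Matrix.submatrix_apply, Matrix.of_apply, id, Fin.revPerm_apply,
        incidence_tailFlag]
      rw [if_neg]
      exact A.notMem_span_of_lt hi.linearIndependent (by simpa using hst)
  rw [Matrix.det_permute'] at h1
  exact right_ne_zero_of_mul (h1.trans_ne one_ne_zero)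

/-- A nonzero determinant has no zero row and no two equal rows. This forces the spans of the tails
of `i'` to agree with those of `i`, and minimality then matches the indices. -/
theorem eq_of_flagFunctional_tailFlag_ne_zero {i i' : Fin n → Fin l} (hi : A.IsStandard i)
    (hi' : A.IsStandard i') (h : A.flagFunctional (A.tailFlag i) (monomial i') ≠ 0) : i' = i := by
  classical
  rw [flagFunctional_monomial] at h
  let X : Fin n → Submodule ℂ (Module.Dual ℂ (Fin (n + 1) → ℂ)) := fun t =>
    Submodule.span ℂ (A.form '' (i '' Set.Ici t))
  have hXanti : Antitone X := fun s t hst =>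
    Submodule.span_mono (Set.image_mono (Set.image_mono (Set.Ici_subset_Ici.2 hst)))
  have hinc : ∀ j t, A.incidence (A.tailFlag i) j t.rev = if A.form j ∈ X t then 1 else 0 :=
    fun j t => A.incidence_tailFlag i j t
  have hnz : ∀ s, ∃ t, A.form (i' s) ∈ X t := by
    intro s
    by_contra! hs
    refine h (Matrix.det_eq_zero_of_row_eq_zero s fun k => ?_)
    rw [Matrix.of_apply, ← Fin.rev_rev k, hinc, if_neg (hs _)]
  have hinj : ∀ s s', (∀ t, A.form (i' s) ∈ X t ↔ A.form (i' s') ∈ X t) → s = s' := by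
    intro s s' hs
    by_contra hne
    refine h (Matrix.det_zero_of_row_eq hne ?_)
    ext k
    simp only [Matrix.of_apply]
    rw [← Fin.rev_rev k, hinc, hinc]
    simp only [hs]
  have key : ∀ t : Fin n, (∀ s, t ≤ s → A.form (i' s) ∈ X t) → i' t = i t := by
    intro t ht
    have hle : Submodule.span ℂ (A.form '' (i' '' Set.Ici t)) ≤ X t := by
      rw [Submodule.span_le]
      rintro _ ⟨_, ⟨s, hs, rfl⟩, rfl⟩
      exact ht s hs
    have hrank : ∀ a : Fin n → Fin l, A.IsStandard a →
        Module.finrank ℂ (Submodule.span ℂ (A.form '' (a '' Set.Ici t))) = n - t := by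
      intro a ha
      have hli : LinearIndependent ℂ fun s : Set.Ici t => A.form (a s) :=
        ha.linearIndependent.comp _ Subtype.val_injective
      have := finrank_span_eq_card hli
      rw [Set.image_image, Set.image_eq_range, this]
      simp
    have heq := Submodule.eq_of_le_of_finrank_eq hle ((hrank i' hi').trans (hrank i hi).symm)
    refine le_antisymm (hi'.le t _ ?_) (hi.le t _ (ht t le_rfl))
    rw [heq]
    exact Submodule.subset_span ⟨_, ⟨t, by simp, rfl⟩, rfl⟩
  -- Given level `t`, `i' t = i t` lies in `X r` exactly for `r ≤ t`; a later `i' s` outside `X (t +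
  -- 1)` would have the same row.
  have main : ∀ (t : ℕ) (ht : t < n), ∀ s, (⟨t, ht⟩ : Fin n) ≤ s → A.form (i' s) ∈ X ⟨t, ht⟩ := by
    intro t
    induction t with
    | zero =>
      intro ht s _
      obtain ⟨t, hst⟩ := hnz s
      exact hXanti (Fin.mk_le_of_le_val (Nat.zero_le _)) hst
    | succ t ih =>
      intro ht s hs
      by_contra hns
      have ht' : t < n := by omega
      have hs' : (⟨t, ht'⟩ : Fin n) ≤ s := le_trans (by simp) hs
      have hit := key _ (ih ht')
      have : s = ⟨t, ht'⟩ := hinj _ _ fun r => by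
        by_cases hr : r ≤ ⟨t, ht'⟩
        · exact iff_of_true (hXanti hr (ih ht' s hs')) (hXanti hr (ih ht' _ le_rfl))
        · have hr' : (⟨t + 1, ht⟩ : Fin n) ≤ r := by
            simp only [Fin.le_def] at hr ⊢
            omega
          refine iff_of_false (fun h => hns (hXanti hr' h)) ?_
          rw [hit]
          exact A.notMem_span_of_lt hi.linearIndependent (not_le.1 hr)
      rw [this] at hs
      simp [Fin.le_def] at hs
  exact funext fun t => key t (main t t.2)

theorem mem_osIdeal_of_flagFunctional_eq_zero (v : Fin n → Fin l → ℂ)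
    (hv : ∀ i : Fin n → Fin l,
      A.flagFunctional (A.tailFlag i) (ExteriorAlgebra.ιMulti ℂ n v) = 0) :
    ExteriorAlgebra.ιMulti ℂ n v ∈ A.osIdeal := by
  classical
  obtain ⟨e, he, f, hf, hef⟩ := Submodule.mem_sup.1 (A.ιMulti_mem_standardSpan v)
  have hset : {e | ∃ i : Fin n → Fin l, A.IsStandard i ∧ (∀ t, A.form (i t) ∈
      (⊤ : Submodule ℂ (Module.Dual ℂ (Fin (n + 1) → ℂ)))) ∧ e = monomial i} =
      Set.range fun i : {i : Fin n → Fin l // A.IsStandard i} => monomial i.1 := by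
    ext e
    simp [eq_comm]
  rw [standardSpan, hset, Submodule.mem_span_range_iff_exists_fun] at hf
  obtain ⟨c, rfl⟩ := hf
  have hc : c = 0 := by
    ext i
    have h1 := hv i
    rw [← hef, map_add, A.flagFunctional_eq_zero_of_mem (A.isFlag_tailFlag i).2
      (fun k => ((A.isFlag_tailFlag i).1 k).1) he, zero_add, map_sum,
      Finset.sum_eq_single i] at h1
    · rw [map_smul, smul_eq_mul] at h1
      exact (mul_eq_zero.1 h1).resolve_right (A.flagFunctional_tailFlag_self i.2)
    · intro i' _ hne
      rw [map_smul]
      by_contra h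
      exact hne (Subtype.ext (A.eq_of_flagFunctional_tailFlag_ne_zero i.2 i'.2
        (right_ne_zero_of_smul h)))
    · simp
  rw [← hef, hc]
  simpa using A.mem_osSubmodule.1 he

/-! ### Passage from the quotient to the ideal. -/

theorem prod_eq_zero_iff_mem_osIdeal {m : ℕ} (M : Matrix (Fin m) (Fin l) ℂ) (w : Fin m → A.OSAlgebra)
    (hw : ∀ r, w r = ∑ i, M r i • A.gen i) :
    (List.ofFn w).prod = 0 ↔ ExteriorAlgebra.ιMulti ℂ m (fun r => M r) ∈ A.osIdeal := by
  have h : w = fun r => A.osIdeal.ringCon.mk' (ExteriorAlgebra.ι ℂ (M r)) := by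
    ext r
    have hr : M r = ∑ i, M r i • Pi.single i (1 : ℂ) := by
      ext j
      simp [Finset.sum_apply, Pi.single_apply]
    rw [hw, hr, map_sum, map_sum]
    refine Finset.sum_congr rfl fun i _ => ?_
    rw [map_smul, ← hr]
    rfl
  have h2 : (List.ofFn w).prod = A.osIdeal.ringCon.mk' (ExteriorAlgebra.ιMulti ℂ m fun r => M r) := by
    rw [ExteriorAlgebra.ιMulti_apply, map_list_prod, List.map_ofFn, h]
    rfl
  rw [h2, ← TwoSidedIdeal.mem_ker, TwoSidedIdeal.ker_ringCon_mk']

end HyperplaneArrangement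

end

theorem mainTheorem1 {n l : ℕ} (A : HyperplaneArrangement n l) (M : Matrix (Fin n) (Fin l) ℂ)
    (w : Fin n → A.OSAlgebra) (hw : ∀ r, w r = ∑ i, M r i • A.gen i) :
    (List.ofFn w).prod = 0 ↔
      ∀ S : Fin n → Set (CPn n), A.IsFlag S →
        Module.finrank ℂ (Submodule.span ℂ (Set.range fun k => A.decoration M (S k))) < n := by
  rw [A.prod_eq_zero_iff_mem_osIdeal M w hw]
  constructor
  · intro h S hS
    rw [← A.flagFunctional_rows_eq_zero_iff]
    exact A.flagFunctional_eq_zero_of_mem hS.2 (fun k => (hS.1 k).1) h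
  · intro h
    refine A.mem_osIdeal_of_flagFunctional_eq_zero _ fun i => ?_
    rw [A.flagFunctional_rows_eq_zero_iff]
    exact h _ (A.isFlag_tailFlag i)
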